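/- For a permutation $w=a_1\cdots a_n\in S_n$ let $\mathfrak S_w\in\mathbb Z[x_1,\dots,x_n]$ be its Schubert polynomial: $\mathfrak S_{w_0}=x_1^{n-1}x_2^{n-2}\cdots x_{n-1}$ for $w_0=n\cdots 21$, and $\mathfrak S_w=\partial_i\mathfrak S_{ws_i}$ whenever $a_i<a_{i+1}$, where $s_i=(i,i+1)$ and $$\partial_i f=\frac{f(x_1,\dots,x_i,x_{i+1},\dots,x_n)-f(x_1,\dots,x_{i+1},x_i,\dots,x_n)}{x_i-x_{i+1}}.$$ Put $\nu_w=\mathfrak S_w(1,\dots,1)$ and, for $v=v_1\cdots v_n\in S_n$, $\lambda_i(v)=\#\{j>i : v_j<v_i\}$. An occurrence of the pattern 132 in $w$ is a triple of positions $i<j<k$ with $a_i<a_k<a_j$; $w$ is called dominant if it has none. Suppose that $w$ has exactly one occurrence of the pattern 132. Then $\nu_w=2$. More precisely, there are positions $i$ and $k>i+1$ such that the unique occurrence is $a_i,a_{i+1},a_k$, and for $w'=ws_i$, the permutation obtained from $w$ by exchanging $a_i$ and $a_{i+1}$: 1. $w'$ is dominant and $\lambda_i(w')=\lambda_{i+1}(w')+2$;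 2. $\mathfrak S_{w'}=x_1^{\lambda_1(w')}x_2^{\lambda_2(w')}\cdots x_{n-1}^{\lambda_{n-1}(w')}$ and $\mathfrak S_w=\partial_i\mathfrak S_{w'}$; 3. $\mathfrak S_w$ is the sum of two distinct monomials, each with coefficient $1$. -/

import Mathlib

namespace Schubert

open MvPolynomial

/-- The difference of a polynomial and its image under exchanging two variables is divisible by the
difference of these variables. -/
theorem sub_dvd_sub_rename_swap {n : ℕ} (i j : Fin n) (f : MvPolynomial (Fin n) ℤ) :
    (X i - X j : MvPolynomial (Fin n) ℤ) ∣ f - rename (Equiv.swap i j) f := by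
  induction f using MvPolynomial.induction_on with
  | C a => simp
  | add p q hp hq =>
    have h := dvd_add hp hq
    rw [map_add]
    convert h using 1
    ring
  | mul_X p m hp =>
    have hX : (X i - X j : MvPolynomial (Fin n) ℤ) ∣ X m - X (Equiv.swap i j m) := by
      rcases eq_or_ne m i with rfl | hi
      · simp
      · rcases eq_or_ne m j with rfl | hj
        · rw [Equiv.swap_apply_right, ← neg_sub (X i)]
          exact (dvd_neg).2 dvd_rfl
        · simp [Equiv.swap_apply_of_ne_of_ne hi hj]
    rw [map_mul, rename_X]
    have h := dvd_add (hp.mul_right (X m)) (hX.mul_left (rename (Equiv.swap i j) p))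
    convert h using 1
    ring

/-- The divided difference `(f - s f) / (x_i - x_j)`, where `s` exchanges `x_i` and `x_j`.
For `i ≠ j` this is the unique polynomial with
`f - s f = (x_i - x_j) * divDiff i j f`, because the polynomial ring is a domain. -/
noncomputable def divDiff {n : ℕ} (i j : Fin n) (f : MvPolynomial (Fin n) ℤ) :
    MvPolynomial (Fin n) ℤ :=
  Classical.choose (sub_dvd_sub_rename_swap i j f)

theorem divDiff_spec {n : ℕ} (i j : Fin n) (f : MvPolynomial (Fin n) ℤ) :
    f - rename (Equiv.swap i j) f = (X i - X j) * divDiff i j f :=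
  Classical.choose_spec (sub_dvd_sub_rename_swap i j f)

/-- `i`, `j` are consecutive positions at which the word `w 0, w 1, …, w (n - 1)` ascends. -/
def IsAscent {n : ℕ} (w : Equiv.Perm (Fin n)) (i j : Fin n) : Prop :=
  (i : ℕ) + 1 = j ∧ w i < w j

/-- Exchanging the entries at an ascent decreases `∑ p, p * w p`. -/
theorem sum_mul_swap_lt {n : ℕ} (w : Equiv.Perm (Fin n)) (i j : Fin n) (h : IsAscent w i j) :
    ∑ p : Fin n, (p : ℕ) * ((w * Equiv.swap i j) p : ℕ) < ∑ p : Fin n, (p : ℕ) * (w p : ℕ) := by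
  obtain ⟨hij, hw⟩ := h
  have hne : j ≠ i := by
    rintro rfl
    omega
  have hj : j ∈ Finset.univ.erase i := by simp [hne]
  rw [← Finset.add_sum_erase _ _ (Finset.mem_univ i), ← Finset.add_sum_erase _ _ hj,
    ← Finset.add_sum_erase _ (fun p : Fin n => (p : ℕ) * (w p : ℕ)) (Finset.mem_univ i),
    ← Finset.add_sum_erase _ (fun p : Fin n => (p : ℕ) * (w p : ℕ)) hj]
  have hrest : ∑ p ∈ (Finset.univ.erase i).erase j, (p : ℕ) * ((w * Equiv.swap i j) p : ℕ)
      = ∑ p ∈ (Finset.univ.erase i).erase j, (p : ℕ) * (w p : ℕ) := by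
    refine Finset.sum_congr rfl fun p hp => ?_
    simp only [Finset.mem_erase, Finset.mem_univ, and_true] at hp
    rw [Equiv.Perm.mul_apply, Equiv.swap_apply_of_ne_of_ne hp.2 hp.1]
  have hlt : (w i : ℕ) < (w j : ℕ) := hw
  rw [hrest]
  simp only [Equiv.Perm.mul_apply, Equiv.swap_apply_left, Equiv.swap_apply_right, ← hij]
  nlinarith

/-- There is a least position at which a permutation with an ascent ascends. -/
theorem exists_first_ascent {n : ℕ} {w : Equiv.Perm (Fin n)}
    (h : ∃ p : Fin n × Fin n, IsAscent w p.1 p.2) :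
    ∃ p : Fin n × Fin n, IsAscent w p.1 p.2 ∧
      ∀ q : Fin n × Fin n, IsAscent w q.1 q.2 → p.1 ≤ q.1 := by
  obtain ⟨p, hp, hmin⟩ := WellFounded.has_min
    (InvImage.wf (fun p : Fin n × Fin n => p.1) (wellFounded_lt (α := Fin n)))
    {p | IsAscent w p.1 p.2} h
  exact ⟨p, hp, fun q hq => not_lt.1 (hmin q hq)⟩

open Classical in
/-- The Schubert polynomial of `w`, in the variables `x_0, …, x_{n-1}` (the positions are numbered
from `0`). The only permutation without an ascent is the longest one, `w₀`, whose polynomial is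
`x_0^{n-1} x_1^{n-2} ⋯ x_{n-2}`; otherwise `𝔖_w = ∂_i 𝔖_{w s_i}` for an ascent `i` of `w`. By the
braid relations for divided differences the ascent does not matter; the first one is taken. This
is `∂_{a_1} ⋯ ∂_{a_p} x^δ` for a reduced word `a_1 ⋯ a_p` of `w⁻¹ w₀`. -/
noncomputable def schubert {n : ℕ} (w : Equiv.Perm (Fin n)) : MvPolynomial (Fin n) ℤ :=
  if h : ∃ p : Fin n × Fin n, IsAscent w p.1 p.2 then
    divDiff (exists_first_ascent h).choose.1 (exists_first_ascent h).choose.2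
      (schubert (w * Equiv.swap (exists_first_ascent h).choose.1 (exists_first_ascent h).choose.2))
  else ∏ i : Fin n, X i ^ (n - 1 - (i : ℕ))
termination_by ∑ p : Fin n, (p : ℕ) * (w p : ℕ)
decreasing_by exact sum_mul_swap_lt w _ _ (exists_first_ascent h).choose_spec.1

/-- The sum of the coefficients of the Schubert polynomial, `ν_w = 𝔖_w(1, …, 1)`. -/
noncomputable def nu {n : ℕ} (w : Equiv.Perm (Fin n)) : ℤ :=
  eval (fun _ => 1) (schubert w)

/-- The occurrences of the pattern 132 in `w`, as triples of positions. -/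
def occurrences132 {n : ℕ} (w : Equiv.Perm (Fin n)) : Finset (Fin n × Fin n × Fin n) :=
  {t | t.1 < t.2.1 ∧ t.2.1 < t.2.2 ∧ w t.1 < w t.2.2 ∧ w t.2.2 < w t.2.1}

/-- A permutation is dominant if it avoids the pattern 132. -/
def IsDominant {n : ℕ} (w : Equiv.Perm (Fin n)) : Prop :=
  occurrences132 w = ∅

/-- `λ_i(v)`, the number of later entries that are smaller than the entry at position `i`. -/
def code {n : ℕ} (v : Equiv.Perm (Fin n)) (i : Fin n) : ℕ :=
  Finset.card {j : Fin n | i < j ∧ v j < v i}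

end Schubert

namespace Schubert

open MvPolynomial

/-! ### Divided differences -/

/-! Uniqueness of the occurrence `(i, j, k)` forces `i` and `j` to be adjacent, since any position
between them would give a second occurrence. It also makes `w * swap i j` dominant, with code values
at `i` and `j` that differ by exactly 2: one from the new descent, one from `k`. The Schubert
polynomial of a dominant permutation is the monomial of its code (`schubert_eq_prod_of_isDominant`),
and `∂_i` sends it to a monomial times `x_i + x_j`. The ascent `i` need not be the first one, which
is the one used in the definition of `schubert`. Hence `schubert_eq_divDiff`, which rests on the
commutation and braid relations. -/

theorem X_sub_X_ne_zero {n : ℕ} {i j : Fin n} (h : i ≠ j) :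
    (X i - X j : MvPolynomial (Fin n) ℤ) ≠ 0 :=
  sub_ne_zero.2 fun e => h (X_injective e)

theorem divDiff_eq_of_mul_eq {n : ℕ} {i j : Fin n} (h : i ≠ j) {f g : MvPolynomial (Fin n) ℤ}
    (hg : f - rename (Equiv.swap i j) f = (X i - X j) * g) : divDiff i j f = g :=
  mul_left_cancel₀ (X_sub_X_ne_zero h) ((divDiff_spec i j f).symm.trans hg)

theorem rename_divDiff_spec {n : ℕ} (s : Equiv.Perm (Fin n)) (i j : Fin n)
    (f : MvPolynomial (Fin n) ℤ) :
    rename s f - rename s (rename (Equiv.swap i j) f)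
      = (X (s i) - X (s j)) * rename s (divDiff i j f) := by
  simpa using congrArg (rename s) (divDiff_spec i j f)

theorem rename_perm_rename {n : ℕ} (s t : Equiv.Perm (Fin n)) (f : MvPolynomial (Fin n) ℤ) :
    rename s (rename t f) = rename (s * t : Equiv.Perm (Fin n)) f := by
  rw [rename_rename]
  rfl

/-- After clearing denominators both sides are `f - s f - t f + s t f`, for the commuting
transpositions `s` and `t`. -/
theorem divDiff_comm {n : ℕ} {i j k l : Fin n} (hij : i ≠ j) (hkl : k ≠ l) (hik : i ≠ k)
    (hil : i ≠ l) (hjk : j ≠ k) (hjl : j ≠ l) (f : MvPolynomial (Fin n) ℤ) :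
    divDiff i j (divDiff k l f) = divDiff k l (divDiff i j f) := by
  refine mul_left_cancel₀ (mul_ne_zero (X_sub_X_ne_zero hij) (X_sub_X_ne_zero hkl)) ?_
  have h1 := divDiff_spec i j (divDiff k l f)
  have h2 := divDiff_spec k l (divDiff i j f)
  have h3 := divDiff_spec k l f
  have h4 := divDiff_spec i j f
  have h5 := rename_divDiff_spec (Equiv.swap i j) k l f
  have h6 := rename_divDiff_spec (Equiv.swap k l) i j f
  have hcomm : Equiv.swap i j * Equiv.swap k l = Equiv.swap k l * Equiv.swap i j :=
    (Equiv.Perm.disjoint_swap_swap (by simp [*])).commute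
  rw [rename_perm_rename, Equiv.swap_apply_of_ne_of_ne hik.symm hjk.symm,
    Equiv.swap_apply_of_ne_of_ne hil.symm hjl.symm] at h5
  rw [rename_perm_rename, Equiv.swap_apply_of_ne_of_ne hik hil,
    Equiv.swap_apply_of_ne_of_ne hjk hjl, ← hcomm] at h6
  linear_combination (X i - X j) * h2 - (X k - X l) * h1 - h3 + h4 + h5 - h6

/-- Multiplied by the Vandermonde product in the three variables, both sides become the alternating
sum of the six images of `f`. -/
theorem divDiff_braid {n : ℕ} {i j k : Fin n} (hij : i ≠ j) (hjk : j ≠ k) (hik : i ≠ k)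
    (f : MvPolynomial (Fin n) ℤ) :
    divDiff i j (divDiff j k (divDiff i j f)) = divDiff j k (divDiff i j (divDiff j k f)) := by
  refine mul_left_cancel₀ (mul_ne_zero (mul_ne_zero (X_sub_X_ne_zero hij) (X_sub_X_ne_zero hjk))
    (X_sub_X_ne_zero hik)) ?_
  have hbraid : Equiv.swap i j * (Equiv.swap j k * Equiv.swap i j)
      = Equiv.swap j k * (Equiv.swap i j * Equiv.swap j k) := by
    have e1 := Equiv.swap_mul_swap_mul_swap hjk.symm hik.symm
    have e2 := Equiv.swap_mul_swap_mul_swap hij hik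
    rw [← mul_assoc, ← mul_assoc, e2, Equiv.swap_comm i j, Equiv.swap_comm j k, e1,
      Equiv.swap_comm]
  -- A divided difference is symmetric in its two variables.
  have hfix : ∀ {a b : Fin n} (_ : a ≠ b) (g : MvPolynomial (Fin n) ℤ),
      rename (Equiv.swap a b) (divDiff a b g) = divDiff a b g := by
    intro a b hab g
    refine mul_left_cancel₀ (X_sub_X_ne_zero hab) ?_
    have h1 := rename_divDiff_spec (Equiv.swap a b) a b g
    rw [rename_perm_rename, Equiv.swap_mul_self, Equiv.swap_apply_left,
      Equiv.swap_apply_right] at h1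
    have h2 := divDiff_spec a b g
    have h3 : rename (1 : Equiv.Perm (Fin n)) g = g := rename_id_apply g
    rw [h3] at h1
    linear_combination h1 + h2
  have ski : Equiv.swap i j k = k := Equiv.swap_apply_of_ne_of_ne hik.symm hjk.symm
  have sik : Equiv.swap j k i = i := Equiv.swap_apply_of_ne_of_ne hij hik
  have a1 := divDiff_spec i j (divDiff j k (divDiff i j f))
  have a2 := divDiff_spec j k (divDiff i j f)
  have a3 := rename_divDiff_spec (Equiv.swap i j) j k (divDiff i j f)
  have a4 := divDiff_spec i j f
  have a5 := rename_divDiff_spec (Equiv.swap j k) i j f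
  have a6 := congrArg (rename (Equiv.swap i j)) a5
  have b1 := divDiff_spec j k (divDiff i j (divDiff j k f))
  have b2 := divDiff_spec i j (divDiff j k f)
  have b3 := rename_divDiff_spec (Equiv.swap j k) i j (divDiff j k f)
  have b4 := divDiff_spec j k f
  have b5 := rename_divDiff_spec (Equiv.swap i j) j k f
  have b6 := congrArg (rename (Equiv.swap j k)) b5
  rw [hfix hij] at a3
  rw [hfix hjk] at b3
  simp only [map_sub, map_mul, rename_X, rename_perm_rename, Equiv.swap_apply_left,
    Equiv.swap_apply_right, ski, sik] at a3 a5 a6 b3 b5 b6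
  rw [hbraid] at a6
  linear_combination -(X j - X k) * (X i - X k) * a1 - (X i - X k) * a2 + (X j - X k) * a3
    - a4 + a5 - a6 + (X i - X j) * (X i - X k) * b1 + (X i - X k) * b2 - (X i - X j) * b3
    + b4 - b5 + b6

/-! ### Independence of the ascent -/

theorem exists_first_ascent_schubert {n : ℕ} {w : Equiv.Perm (Fin n)}
    (h : ∃ p : Fin n × Fin n, IsAscent w p.1 p.2) :
    ∃ i j : Fin n, IsAscent w i j ∧ (∀ a b : Fin n, IsAscent w a b → i ≤ a) ∧
      schubert w = divDiff i j (schubert (w * Equiv.swap i j)) := by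
  refine ⟨_, _, (exists_first_ascent h).choose_spec.1,
    fun a b hab => (exists_first_ascent h).choose_spec.2 (a, b) hab, ?_⟩
  rw [schubert, dif_pos h]

theorem schubert_of_no_ascent {n : ℕ} {w : Equiv.Perm (Fin n)}
    (h : ¬ ∃ p : Fin n × Fin n, IsAscent w p.1 p.2) :
    schubert w = ∏ i : Fin n, X i ^ (n - 1 - (i : ℕ)) := by
  rw [schubert, dif_neg h]

/-- The given ascent is compared with the first one. By induction both can be continued to a common
permutation: by the braid relation if the ascents overlap, by commutation if they are disjoint. -/
theorem schubert_eq_divDiff {n : ℕ} (w : Equiv.Perm (Fin n)) (i j : Fin n)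
    (h : IsAscent w i j) : schubert w = divDiff i j (schubert (w * Equiv.swap i j)) := by
  induction hm : ∑ p : Fin n, (p : ℕ) * (w p : ℕ) using Nat.strong_induction_on
    generalizing w i j with
  | _ m ih =>
  subst hm
  obtain ⟨p, q, hpq, hmin, hS⟩ := exists_first_ascent_schubert ⟨(i, j), h⟩
  have hpi : p ≤ i := hmin i j h
  have hlt1 := sum_mul_swap_lt w p q hpq
  have hlt2 := sum_mul_swap_lt w i j h
  have hq : (p : ℕ) + 1 = q := hpq.1
  have hj : (i : ℕ) + 1 = j := h.1
  rcases hpi.eq_or_lt with rfl | hpi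
  · obtain rfl : q = j := Fin.ext (hq.symm.trans hj)
    exact hS
  have npq : p ≠ q := by rintro rfl; omega
  have nij : i ≠ j := by rintro rfl; omega
  have npi : p ≠ i := hpi.ne
  have npj : p ≠ j := by rintro rfl; omega
  have nqj : q ≠ j := by rintro rfl; omega
  have hlt : (p : ℕ) < i := hpi
  rcases eq_or_ne q i with rfl | nqi
  · have s1 : Equiv.swap p q j = j := Equiv.swap_apply_of_ne_of_ne npj.symm nij.symm
    have s2 : Equiv.swap q j p = p := Equiv.swap_apply_of_ne_of_ne npq npj
    have wpq : w p < w q := hpq.2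
    have wqj : w q < w j := h.2
    have u1 : IsAscent (w * Equiv.swap p q) q j :=
      ⟨hj, by simpa [s1] using wpq.trans wqj⟩
    have u2 : IsAscent (w * Equiv.swap p q * Equiv.swap q j) p q :=
      ⟨hq, by simpa [s1, s2] using wqj⟩
    have v1 : IsAscent (w * Equiv.swap q j) p q :=
      ⟨hq, by simpa [s2] using wpq.trans wqj⟩
    have v2 : IsAscent (w * Equiv.swap q j * Equiv.swap p q) q j :=
      ⟨hj, by simpa [s1, s2] using wpq⟩
    have hu := sum_mul_swap_lt _ _ _ u1
    have hv := sum_mul_swap_lt _ _ _ v1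
    have hbraid : w * Equiv.swap p q * Equiv.swap q j * Equiv.swap p q
        = w * Equiv.swap q j * Equiv.swap p q * Equiv.swap q j := by
      ext x
      congr 1
      simp only [Equiv.Perm.mul_apply]
      congr 1
      rcases eq_or_ne x p with rfl | hxp
      · simp [s1, s2]
      rcases eq_or_ne x q with rfl | hxq
      · simp [s1, s2]
      rcases eq_or_ne x j with rfl | hxj
      · simp [s1, s2]
      simp [Equiv.swap_apply_of_ne_of_ne, *]
    rw [hS, ih _ hlt1 _ _ _ u1 rfl, ih _ (hu.trans hlt1) _ _ _ u2 rfl,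
      ih _ hlt2 _ _ _ v1 rfl, ih _ (hv.trans hlt2) _ _ _ v2 rfl, hbraid]
    exact divDiff_braid npq nij npj _
  · have u1 : IsAscent (w * Equiv.swap p q) i j :=
      ⟨hj, by simpa [Equiv.swap_apply_of_ne_of_ne npi.symm nqi.symm,
        Equiv.swap_apply_of_ne_of_ne npj.symm nqj.symm] using h.2⟩
    have v1 : IsAscent (w * Equiv.swap i j) p q :=
      ⟨hq, by simpa [Equiv.swap_apply_of_ne_of_ne npi npj,
        Equiv.swap_apply_of_ne_of_ne nqi nqj] using hpq.2⟩
    have hcomm : Equiv.swap p q * Equiv.swap i j = Equiv.swap i j * Equiv.swap p q :=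
      (Equiv.Perm.disjoint_swap_swap (by simp [*])).commute
    rw [hS, ih _ hlt1 _ _ _ u1 rfl, ih _ hlt2 _ _ _ v1 rfl, mul_assoc, mul_assoc, hcomm]
    exact divDiff_comm npq nij npi npj nqi nqj _

/-! ### Codes and occurrences after exchanging the entries at an ascent -/

theorem mem_occurrences132 {n : ℕ} {w : Equiv.Perm (Fin n)} {a b c : Fin n} :
    (a, b, c) ∈ occurrences132 w ↔ a < b ∧ b < c ∧ w a < w c ∧ w c < w b := by
  simp [occurrences132]

theorem lt_iff_of_succ {n : ℕ} {i j : Fin n} (h : (i : ℕ) + 1 = j) (k : Fin n) :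
    i < k ↔ k = j ∨ j < k := by
  rw [Fin.lt_def, Fin.lt_def, Fin.ext_iff]
  omega

theorem code_mul_swap_of_ne {n : ℕ} (w : Equiv.Perm (Fin n)) {i j m : Fin n}
    (h : (i : ℕ) + 1 = j) (hi : m ≠ i) (hj : m ≠ j) :
    code (w * Equiv.swap i j) m = code w m := by
  refine Finset.card_equiv (Equiv.swap i j) fun k => ?_
  have hs : m < Equiv.swap i j k ↔ m < k := by
    have hi' := Fin.val_ne_of_ne hi
    have hj' := Fin.val_ne_of_ne hj
    rcases eq_or_ne k i with rfl | hki
    · rw [Equiv.swap_apply_left, Fin.lt_def, Fin.lt_def]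
      omega
    rcases eq_or_ne k j with rfl | hkj
    · rw [Equiv.swap_apply_right, Fin.lt_def, Fin.lt_def]
      omega
    rw [Equiv.swap_apply_of_ne_of_ne hki hkj]
  simp [hs, Equiv.swap_apply_of_ne_of_ne hi hj]

theorem code_mul_swap_right {n : ℕ} {w : Equiv.Perm (Fin n)} {i j : Fin n}
    (h : IsAscent w i j) : code (w * Equiv.swap i j) j = code w i := by
  have hij : i < j := (lt_iff_of_succ h.1 j).2 (Or.inl rfl)
  unfold code
  congr 1
  ext k
  simp only [Finset.mem_filter, Finset.mem_univ, true_and, Equiv.Perm.mul_apply,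
    Equiv.swap_apply_right, lt_iff_of_succ h.1 k]
  constructor
  · rintro ⟨hk, hw⟩
    rw [Equiv.swap_apply_of_ne_of_ne (hij.trans hk).ne' hk.ne'] at hw
    exact ⟨Or.inr hk, hw⟩
  · rintro ⟨rfl | hk, hw⟩
    · exact absurd h.2 hw.not_gt
    · rw [Equiv.swap_apply_of_ne_of_ne (hij.trans hk).ne' hk.ne']
      exact ⟨hk, hw⟩

theorem code_mul_swap_left {n : ℕ} {w : Equiv.Perm (Fin n)} {i j : Fin n}
    (h : IsAscent w i j) : code (w * Equiv.swap i j) i = code w j + 1 := by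
  have hij : i < j := (lt_iff_of_succ h.1 j).2 (Or.inl rfl)
  unfold code
  -- The extra inversion is the descent created at `(i, j)`.
  rw [← Finset.card_insert_of_notMem (a := j) (by simp)]
  congr 1
  ext k
  simp only [Finset.mem_filter, Finset.mem_univ, true_and, Equiv.Perm.mul_apply,
    Equiv.swap_apply_left, lt_iff_of_succ h.1 k, Finset.mem_insert]
  constructor
  · rintro ⟨rfl | hk, hw⟩
    · exact Or.inl rfl
    · rw [Equiv.swap_apply_of_ne_of_ne (hij.trans hk).ne' hk.ne'] at hw
      exact Or.inr ⟨hk, hw⟩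
  · rintro (rfl | ⟨hk, hw⟩)
    · simpa using h.2
    · rw [Equiv.swap_apply_of_ne_of_ne (hij.trans hk).ne' hk.ne']
      exact ⟨Or.inr hk, hw⟩

/-- A later entry below `w j` lies either below `w i` or strictly between the two; the latter are
the occurrences on `i, j`. -/
theorem code_right_of_ascent {n : ℕ} {w : Equiv.Perm (Fin n)} {i j : Fin n}
    (h : IsAscent w i j) :
    code w j = code w i + Finset.card {k : Fin n | (i, j, k) ∈ occurrences132 w} := by
  have hij : i < j := (lt_iff_of_succ h.1 j).2 (Or.inl rfl)
  unfold code
  rw [← Finset.card_union_of_disjoint]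
  · congr 1
    ext k
    simp only [Finset.mem_filter, Finset.mem_univ, true_and, Finset.mem_union,
      mem_occurrences132, lt_iff_of_succ h.1 k]
    constructor
    · rintro ⟨hk, hw⟩
      rcases lt_trichotomy (w k) (w i) with hki | hki | hki
      · exact Or.inl ⟨Or.inr hk, hki⟩
      · exact absurd (w.injective hki) (hij.trans hk).ne'
      · exact Or.inr ⟨hij, hk, hki, hw⟩
    · rintro (⟨rfl | hk, hw⟩ | ⟨-, hk, -, hw⟩)
      · exact absurd h.2 hw.not_gt
      · exact ⟨hk, hw.trans h.2⟩
      · exact ⟨hk, hw⟩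
  · refine Finset.disjoint_left.2 fun k hk hk' => ?_
    simp only [Finset.mem_filter, Finset.mem_univ, true_and, mem_occurrences132] at hk hk'
    exact hk.2.not_gt hk'.2.2.1

theorem swap_lt_swap_of_succ {n : ℕ} {i j a b : Fin n} (h : (i : ℕ) + 1 = j) (hab : a < b)
    (hne : ¬ (a = i ∧ b = j)) : Equiv.swap i j a < Equiv.swap i j b := by
  simp only [Equiv.swap_apply_def]
  rw [Fin.lt_def] at hab
  simp only [Fin.ext_iff] at hne
  split_ifs <;> simp only [Fin.lt_def, Fin.ext_iff] at * <;> omega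

/-- Exchanging adjacent positions preserves the order of all other pairs, so an occurrence is
transported unless it uses both `i` and `j`. They cannot play "13", because there is now a descent;
playing "32" they leave a smaller entry before `i`. -/
theorem mem_occurrences132_mul_swap {n : ℕ} {w : Equiv.Perm (Fin n)} {i j a b c : Fin n}
    (h : IsAscent w i j) (ho : (a, b, c) ∈ occurrences132 (w * Equiv.swap i j)) :
    (a < i ∧ w a < w i) ∨
      (Equiv.swap i j a, Equiv.swap i j b, Equiv.swap i j c) ∈ occurrences132 w := by
  obtain ⟨hab, hbc, hac', hcb'⟩ := mem_occurrences132.1 ho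
  have hij : i < j := (lt_iff_of_succ h.1 j).2 (Or.inl rfl)
  by_cases hx : b = i ∧ c = j
  · obtain ⟨rfl, rfl⟩ := hx
    left
    refine ⟨hab, ?_⟩
    simpa [Equiv.swap_apply_of_ne_of_ne hab.ne (hab.trans hij).ne] using hac'
  · right
    refine mem_occurrences132.2 ⟨swap_lt_swap_of_succ h.1 hab ?_,
      swap_lt_swap_of_succ h.1 hbc hx, hac', hcb'⟩
    rintro ⟨rfl, rfl⟩
    have := hac'.trans hcb'
    simp only [Equiv.Perm.mul_apply, Equiv.swap_apply_left, Equiv.swap_apply_right] at this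
    exact this.not_gt h.2

theorem lt_of_forall_succ_lt {n : ℕ} {w : Equiv.Perm (Fin n)} {t : Fin n}
    (hw : ∀ a b : Fin n, (a : ℕ) + 1 = b → b ≤ t → w b < w a) :
    ∀ h : Fin n, h < t → w t < w h := by
  suffices H : ∀ (d : ℕ) (h : Fin n), (h : ℕ) + d + 1 = t → w t < w h by
    intro h ht
    rw [Fin.lt_def] at ht
    exact H (t - h - 1) h (by omega)
  intro d
  induction d with
  | zero => exact fun h hh => hw h t hh le_rfl
  | succ d ih =>
    intro h hh
    have hn : (h : ℕ) + 1 < n := by have := t.isLt; omega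
    refine (ih ⟨h + 1, hn⟩ (by simp only; omega)).trans (hw h ⟨h + 1, hn⟩ rfl ?_)
    rw [Fin.le_def]
    simp only
    omega

/-! ### Dominant permutations -/

/-- The symmetric factor `x^b` passes through the divided difference, which then acts on `x_i ^ r`
alone. The cases needed are `r = 1` and `r = 2`. -/
theorem divDiff_prod_X_pow {n : ℕ} {i j : Fin n} (hij : i ≠ j) (c b : Fin n → ℕ) (r : ℕ)
    (hi : c i = b i + r) (hb : b i = b j) (hc : ∀ m, m ≠ i → c m = b m)
    (g : MvPolynomial (Fin n) ℤ) (hg : X i ^ r - X j ^ r = (X i - X j) * g) :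
    divDiff i j (∏ m, X m ^ c m) = (∏ m, X m ^ b m) * g := by
  have hcb : (∏ m, X m ^ c m : MvPolynomial (Fin n) ℤ) = (∏ m, X m ^ b m) * X i ^ r := by
    rw [← Finset.mul_prod_erase _ _ (Finset.mem_univ i),
      ← Finset.mul_prod_erase _ (fun m => (X m ^ b m : MvPolynomial (Fin n) ℤ))
        (Finset.mem_univ i), hi, pow_add,
      Finset.prod_congr rfl fun m hm => by rw [hc m (Finset.ne_of_mem_erase hm)]]
    ring
  have hsym : rename (Equiv.swap i j) (∏ m, X m ^ b m : MvPolynomial (Fin n) ℤ)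
      = ∏ m, X m ^ b m := by
    simp only [map_prod, map_pow, rename_X]
    refine Fintype.prod_equiv (Equiv.swap i j) _ _ fun m => ?_
    congr 1
    simp only [Equiv.swap_apply_def]
    split_ifs with h1 h2
    · rw [h1, hb]
    · rw [h2, hb]
    · rfl
  apply divDiff_eq_of_mul_eq hij
  rw [hcb, map_mul, hsym, map_pow, rename_X, Equiv.swap_apply_left]
  linear_combination (∏ m, X m ^ b m) * hg

theorem schubert_eq_prod_of_isDominant {n : ℕ} (w : Equiv.Perm (Fin n)) (hw : IsDominant w) :
    schubert w = ∏ m : Fin n, X m ^ code w m := by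
  induction hm : ∑ p : Fin n, (p : ℕ) * (w p : ℕ) using Nat.strong_induction_on
    generalizing w with
  | _ m ih =>
  subst hm
  by_cases h : ∃ p : Fin n × Fin n, IsAscent w p.1 p.2
  · obtain ⟨i, j, hij, hmin, hS⟩ := exists_first_ascent_schubert h
    have hlt : i < j := (lt_iff_of_succ hij.1 j).2 (Or.inl rfl)
    -- Entries decrease up to the first ascent, so the exchange there cannot create an occurrence.
    -- At a later ascent it could.
    have hprefix : ∀ a : Fin n, a < i → w i < w a := by
      refine lt_of_forall_succ_lt fun a b hab hb => ?_
      have hlt' : a < b := (lt_iff_of_succ hab b).2 (Or.inl rfl)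
      by_contra hcon
      exact (hmin a b ⟨hab, (not_lt.1 hcon).lt_of_ne fun e => hlt'.ne (w.injective e)⟩).not_gt
        (hlt'.trans_le hb)
    have hdom : IsDominant (w * Equiv.swap i j) := by
      refine Finset.eq_empty_of_forall_notMem ?_
      rintro ⟨a, b, c⟩ ho
      rcases mem_occurrences132_mul_swap hij ho with ⟨ha, hwa⟩ | ho
      · exact hwa.not_gt (hprefix a ha)
      · rw [hw] at ho
        exact Finset.notMem_empty _ ho
    have hji : code w j = code w i := by
      rw [code_right_of_ascent hij, hw]
      simp
    rw [hS, ih _ (sum_mul_swap_lt w i j hij) _ hdom rfl,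
      divDiff_prod_X_pow hlt.ne _ (code w) 1 (by rw [code_mul_swap_left hij, hji]) hji.symm ?_ 1
        (by ring), mul_one]
    intro m hmi
    rcases eq_or_ne m j with rfl | hmj
    · rw [code_mul_swap_right hij, hji]
    · exact code_mul_swap_of_ne w hij.1 hmi hmj
  · rw [schubert_of_no_ascent h]
    refine Finset.prod_congr rfl fun i _ => ?_
    have hcode : code w i = (Finset.Ioi i).card := by
      unfold code
      congr 1
      ext k
      simp only [Finset.mem_filter, Finset.mem_univ, true_and, Finset.mem_Ioi,
        and_iff_left_iff_imp]
      refine fun hk => lt_of_forall_succ_lt (fun a b hab _ => ?_) i hk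
      have hlt' : a < b := (lt_iff_of_succ hab b).2 (Or.inl rfl)
      by_contra hcon
      exact h ⟨(a, b), hab, (not_lt.1 hcon).lt_of_ne fun e => hlt'.ne (w.injective e)⟩
    rw [hcode, Fin.card_Ioi]

/-! ### Permutations with exactly one occurrence of 132 -/

theorem succ_of_occurrences132_eq_singleton {n : ℕ} {w : Equiv.Perm (Fin n)} {i j k : Fin n}
    (hw : occurrences132 w = {(i, j, k)}) : (i : ℕ) + 1 = j := by
  have hmem : (i, j, k) ∈ occurrences132 w := by simp [hw]
  obtain ⟨hij, hjk, hik', hkj'⟩ := mem_occurrences132.1 hmem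
  by_contra hne
  have hij' : (i : ℕ) < j := hij
  obtain ⟨m, him, hmj⟩ : ∃ m : Fin n, i < m ∧ m < j :=
    ⟨⟨i + 1, by have := j.isLt; omega⟩, by rw [Fin.lt_def]; simp, by
      rw [Fin.lt_def]; simp only; omega⟩
  rcases lt_trichotomy (w m) (w k) with hmk | hmk | hmk
  · have h : (m, j, k) ∈ occurrences132 w := mem_occurrences132.2 ⟨hmj, hjk, hmk, hkj'⟩
    rw [hw, Finset.mem_singleton, Prod.mk.injEq] at h
    exact him.ne' h.1
  · exact (hmj.trans hjk).ne (w.injective hmk)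
  · have h : (i, m, k) ∈ occurrences132 w :=
      mem_occurrences132.2 ⟨him, hmj.trans hjk, hik', hmk⟩
    rw [hw, Finset.mem_singleton, Prod.mk.injEq, Prod.mk.injEq] at h
    exact hmj.ne h.2.1

theorem isDominant_mul_swap_of_occurrences132_eq_singleton {n : ℕ} {w : Equiv.Perm (Fin n)}
    {i j k : Fin n} (hw : occurrences132 w = {(i, j, k)}) :
    IsDominant (w * Equiv.swap i j) := by
  have hmem : (i, j, k) ∈ occurrences132 w := by simp [hw]
  obtain ⟨hij, hjk, hik', hkj'⟩ := mem_occurrences132.1 hmem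
  have hasc : IsAscent w i j := ⟨succ_of_occurrences132_eq_singleton hw, hik'.trans hkj'⟩
  refine Finset.eq_empty_of_forall_notMem ?_
  rintro ⟨a, b, c⟩ ho
  -- A smaller entry before `i` would give a second occurrence `(a, j, k)`; a transported occurrence
  -- must be `(i, j, k)`, which forces `a = j` and `b = i`, against `a < b`.
  rcases mem_occurrences132_mul_swap hasc ho with ⟨ha, hwa⟩ | ho'
  · have h : (a, j, k) ∈ occurrences132 w :=
      mem_occurrences132.2 ⟨ha.trans hij, hjk, hwa.trans hik', hkj'⟩
    rw [hw, Finset.mem_singleton, Prod.mk.injEq] at h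
    exact ha.ne h.1
  · rw [hw, Finset.mem_singleton, Prod.mk.injEq, Prod.mk.injEq, Equiv.swap_apply_eq_iff,
      Equiv.swap_apply_eq_iff, Equiv.swap_apply_left, Equiv.swap_apply_right] at ho'
    obtain ⟨rfl, rfl, -⟩ := ho'
    exact (mem_occurrences132.1 ho).1.not_gt hij

theorem prod_X_pow_eq_monomial {n : ℕ} (b : Fin n → ℕ) :
    (∏ m, X m ^ b m : MvPolynomial (Fin n) ℤ)
      = monomial (Finsupp.equivFunOnFinite.symm b) 1 := by
  rw [monomial_eq, C_1, one_mul, Finsupp.prod_fintype _ _ fun _ => pow_zero _]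
  rfl

end Schubert

theorem mainTheorem3 (n : ℕ) (w : Equiv.Perm (Fin n))
    (hw : (Schubert.occurrences132 w).card = 1) :
    Schubert.nu w = 2 ∧
    ∃ i j k : Fin n,
      (i : ℕ) + 1 = j ∧
      Schubert.occurrences132 w = {(i, j, k)} ∧
      Schubert.IsDominant (w * Equiv.swap i j) ∧
      Schubert.code (w * Equiv.swap i j) i = Schubert.code (w * Equiv.swap i j) j + 2 ∧
      Schubert.schubert (w * Equiv.swap i j) =
        ∏ m : Fin n, MvPolynomial.X m ^ Schubert.code (w * Equiv.swap i j) m ∧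
      Schubert.schubert w =
        Schubert.divDiff i j (Schubert.schubert (w * Equiv.swap i j)) ∧
      ∃ d e : Fin n →₀ ℕ, d ≠ e ∧
        Schubert.schubert w = MvPolynomial.monomial d 1 + MvPolynomial.monomial e 1 := by
  obtain ⟨⟨i, j, k⟩, ht⟩ := Finset.card_eq_one.1 hw
  have hmem : (i, j, k) ∈ Schubert.occurrences132 w := by simp [ht]
  obtain ⟨hij, -, hik, hkj⟩ := Schubert.mem_occurrences132.1 hmem
  have hsucc := Schubert.succ_of_occurrences132_eq_singleton ht
  have hasc : Schubert.IsAscent w i j := ⟨hsucc, hik.trans hkj⟩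
  have hdom := Schubert.isDominant_mul_swap_of_occurrences132_eq_singleton ht
  have hcode : Schubert.code (w * Equiv.swap i j) i
      = Schubert.code (w * Equiv.swap i j) j + 2 := by
    rw [Schubert.code_mul_swap_left hasc, Schubert.code_mul_swap_right hasc,
      Schubert.code_right_of_ascent hasc, ht]
    simp [Finset.filter_eq']
  have hprod := Schubert.schubert_eq_prod_of_isDominant _ hdom
  have hdiff := Schubert.schubert_eq_divDiff w i j hasc
  -- Lowering the exponent at `i` by 2 gives the part symmetric in `x_i, x_j`; what remains is `x_i
  -- ^ 2`, with divided difference `x_i + x_j`.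
  let b : Fin n → ℕ := Function.update (Schubert.code (w * Equiv.swap i j)) i
    (Schubert.code (w * Equiv.swap i j) j)
  have hS : Schubert.schubert w
      = (∏ m, MvPolynomial.X m ^ b m) * (MvPolynomial.X i + MvPolynomial.X j) := by
    rw [hdiff, hprod]
    refine Schubert.divDiff_prod_X_pow hij.ne _ b 2 ?_ ?_ ?_ _ (by ring)
    · simpa [b] using hcode
    · simp [b, hij.ne']
    · intro m hm
      simp [b, hm]
  refine ⟨?_, i, j, k, hsucc, ht, hdom, hcode, hprod, hdiff,
    Finsupp.equivFunOnFinite.symm b + Finsupp.single i 1,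
    Finsupp.equivFunOnFinite.symm b + Finsupp.single j 1, ?_, ?_⟩
  · rw [Schubert.nu, hS]
    simp
  · intro h
    have := Finsupp.single_left_injective one_ne_zero (add_left_cancel h)
    exact hij.ne this
  · rw [hS, Schubert.prod_X_pow_eq_monomial, mul_add, MvPolynomial.X, MvPolynomial.X,
      MvPolynomial.monomial_mul, MvPolynomial.monomial_mul, one_mul]
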